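/- Let $n\ge 2$, let $(\mathsf X_i,\mathcal B_i,\mu_i)$, $i=1,\dots,n$, be $\sigma$-finite measure spaces in which singletons are measurable, and let $\Pi$ be a probability measure on $\mathsf X_1\times\dots\times\mathsf X_n$ with an everywhere specified measurable density $\pi$ with respect to $\mu_1\times\dots\times\mu_n$. For $\Lambda\subset[n]$ with $|\Lambda|\le n-1$, write $-\Lambda=[n]\setminus\Lambda$, and let $\pi_\Lambda(y)=\int \pi\,\mathrm d\mu_{-\Lambda}$ (the coordinates in $\Lambda$ being fixed at $y$) be the marginal density at $y\in\mathsf X_\Lambda=\prod_{i\in\Lambda}\mathsf X_i$ (with $\pi_\emptyset=1$). If $0<\pi_\Lambda(y)<\infty$, let $\pi_{-\Lambda\mid\Lambda}(\cdot\mid y)=\pi(y,\cdot)/\pi_\Lambda(y)$ be the conditional density on $\mathsf X_{-\Lambda}$; for all other $y$ let it be an arbitrary probability density with respect to $\mu_{-\Lambda}$. For $1\le l\le n-|\Lambda|$, the random-scan Gibbs sampler with block size $l$ targeting $\pi_{-\Lambda\mid\Lambda}(\cdot\mid y)$ moves from $z\in\mathsf X_{-\Lambda}$ as follows: it chooses $\Gamma\subset-\Lambda$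 with $|\Gamma|=l$ uniformly at random and redraws the coordinates in $\Gamma$ from $\pi_{\Gamma\mid-\Gamma}(\cdot\mid x_{-\Gamma})$, where $x$ is the point with $x_\Lambda=y$, $x_{-\Lambda}=z$. Let $\mathrm{gap}(\Lambda,y,l)=1-\|K\|$ be its spectral gap, where $\|K\|=\sup \|Kf\|_{L^2(\varpi)}/\|f\|_{L^2(\varpi)}$ over the nonzero $f\in L^2(\varpi)$ with $\varpi$-mean zero, $K$ is its Markov operator and $\varpi$ is the law with density $\pi_{-\Lambda\mid\Lambda}(\cdot\mid y)$. For $1\le l\le m\le n$ put \[ \mathrm{Gap}(m,l)=\min_{|\Lambda|=n-m}\ \inf_{y:\,0<\pi_\Lambda(y)<\infty}\mathrm{gap}(\Lambda,y,l). \] For a random vector $(Y_1,\dots,Y_m)$, the summation-based correlation coefficient is \[ s_*(Y_1,\dots,Y_m)=\sup\frac{\mathbb E\big[\big(\sum_{i=1}^m f_i(Y_i)\big)^2\big]}{m\sum_{i=1}^m\mathbb E[f_i(Y_i)^2]}, \] the supremum being over square-integrable, mean-zero functions $f_i(Y_i)$ that are not all almost surely zero. (Here, and in $\|K\|$, the supremum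 of the empty set is $0$.) For $2\le m\le n$ let \[ S(m)=\max_{|\Lambda|=n-m}\ \sup_{y:\,0<\pi_\Lambda(y)<\infty}s_*(Y_1,\dots,Y_m),\qquad (Y_1,\dots,Y_m)\sim\pi_{-\Lambda\mid\Lambda}(\cdot\mid y). \] Then, for every $m\in\{2,\dots,n\}$, \[ \mathrm{Gap}(m,m-1)\ge 1-S(m), \] and, for every $l\in\{1,\dots,n-1\}$, \[ \mathrm{Gap}(n,l)\ge\prod_{m=l+1}^n[1-S(m)]. \] -/

import Mathlib

open MeasureTheory
open scoped ENNReal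

noncomputable section

/-- The norm of the operator `f ↦ (x ↦ ∫ f dK(x, ·))` on `L²₀(ν)`, the space of square-integrable
functions of mean zero: the supremum of `‖K f‖ / ‖f‖` over the nonzero `f` in `L²₀(ν)`.
It is `0` if `L²₀(ν)` is trivial. -/
def markovNorm {E : Type*} [MeasurableSpace E] (ν : Measure E) (K : E → Measure E) : ℝ≥0∞ :=
  ⨆ (f : E → ℝ) (_ : MemLp f 2 ν) (_ : ∫ x, f x ∂ν = 0) (_ : eLpNorm f 2 ν ≠ 0),
    eLpNorm (fun x => ∫ x', f x' ∂(K x)) 2 ν / eLpNorm f 2 ν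

/-- The spectral gap `1 - ‖K‖` of a chain with kernel `K` that is reversible with respect to `ν`.
(The values are extended reals, so that nothing is truncated and infima always make sense.) -/
def spectralGap {E : Type*} [MeasurableSpace E] (ν : Measure E) (K : E → Measure E) : EReal :=
  1 - (markovNorm ν K : EReal)

/-- The summation-based correlation coefficient `s_*(Y₁, …, Yₘ)` of a random vector with law `ω`
on a product of `m = Fintype.card κ` spaces: the supremum of
`E[(∑ᵢ fᵢ(Yᵢ))²] / (m ∑ᵢ E[fᵢ(Yᵢ)²])` over all `fᵢ ∈ L²₀(ωᵢ)`, not all zero, where `ωᵢ` is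
the `i`-th marginal of `ω`. It is `0` if all the spaces `L²₀(ωᵢ)` are trivial. -/
def sumCorr {κ : Type*} [Fintype κ] {Y : κ → Type*} [∀ k, MeasurableSpace (Y k)]
    (ω : Measure (∀ k, Y k)) : ℝ≥0∞ :=
  ⨆ (f : ∀ k, Y k → ℝ)
    (_ : ∀ k, MemLp (f k) 2 (ω.map (fun y => y k)) ∧ ∫ t, f k t ∂(ω.map (fun y => y k)) = 0)
    (_ : ∃ k, 0 < ∫⁻ y, ENNReal.ofReal ((f k (y k)) ^ 2) ∂ω),
    (∫⁻ y, ENNReal.ofReal ((∑ k, f k (y k)) ^ 2) ∂ω) /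
      ((Fintype.card κ : ℝ≥0∞) * ∑ k, ∫⁻ y, ENNReal.ofReal ((f k (y k)) ^ 2) ∂ω)

section Gibbs

variable {ι : Type*} [Fintype ι] [DecidableEq ι] {X : ι → Type*} [∀ i, MeasurableSpace (X i)]

/-- `Admissible μ p Γ x`: conditioning on the coordinates outside `Γ`, with values read off from
`x`, is possible. Here `(∫⋯∫⁻_Γ, p ∂μ) x`, the integral of the density `p` over the coordinates in
`Γ` with the other ones fixed at those of `x`, is the marginal density of the coordinates outside
`Γ` at the point `x` (the coordinates of `x` in `Γ` are irrelevant). -/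
def Admissible (μ : ∀ i, Measure (X i)) (p : (∀ i, X i) → ℝ≥0∞) (Γ : Finset ι) (x : ∀ i, X i) :
    Prop :=
  0 < (∫⋯∫⁻_Γ, p ∂μ) x ∧ (∫⋯∫⁻_Γ, p ∂μ) x < ∞

open Classical in
/-- The conditional density of the coordinates in `Γ`, given that those outside `Γ` are equal to
those of `x`. Where it is not determined by `p` it is the prescribed density `δ Γ`. -/
def condDensity (μ : ∀ i, Measure (X i)) (p : (∀ i, X i) → ℝ≥0∞)
    (δ : ∀ Γ : Finset ι, (∀ i : ↥(Γᶜ), X i) → (∀ i : ↥Γ, X i) → ℝ≥0∞)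
    (Γ : Finset ι) (x : ∀ i, X i) (w : ∀ i : ↥Γ, X i) : ℝ≥0∞ :=
  if Admissible μ p Γ x then p (Function.updateFinset x Γ w) / (∫⋯∫⁻_Γ, p ∂μ) x
  else δ Γ (Finset.restrict (Γᶜ) x) w

/-- The conditional law of the coordinates in `Γ`, given that those outside `Γ` are equal to those
of `x`. -/
def condLaw (μ : ∀ i, Measure (X i)) (p : (∀ i, X i) → ℝ≥0∞)
    (δ : ∀ Γ : Finset ι, (∀ i : ↥(Γᶜ), X i) → (∀ i : ↥Γ, X i) → ℝ≥0∞)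
    (Γ : Finset ι) (x : ∀ i, X i) : Measure (∀ i : ↥Γ, X i) :=
  (Measure.pi fun i : ↥Γ => μ i).withDensity (condDensity μ p δ Γ x)

/-- One step, from the state `z`, of the random-scan Gibbs sampler with block size `l` that targets
`condLaw μ p δ Γ x`: choose `B ⊆ Γ` with `#B = l` uniformly at random, and redraw the coordinates
in `B` from their conditional law given all the coordinates outside `B` (those of `z` inside `Γ`,
those of `x` outside `Γ`). -/
def gibbsKernel (μ : ∀ i, Measure (X i)) (p : (∀ i, X i) → ℝ≥0∞)
    (δ : ∀ Γ : Finset ι, (∀ i : ↥(Γᶜ), X i) → (∀ i : ↥Γ, X i) → ℝ≥0∞)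
    (Γ : Finset ι) (x : ∀ i, X i) (l : ℕ) (z : ∀ i : ↥Γ, X i) : Measure (∀ i : ↥Γ, X i) :=
  ((Γ.card.choose l : ℝ≥0∞)⁻¹) • ∑ B ∈ Γ.powersetCard l,
    (condLaw μ p δ B (Function.updateFinset x Γ z)).map
      (fun w => Finset.restrict Γ (Function.updateFinset (Function.updateFinset x Γ z) B w))

/-- `Gap(m, l)`: the least spectral gap of the Gibbs samplers with block size `l` that target the
`m`-dimensional conditional laws. The set `Γ` of free coordinates is the complement of the set of
the coordinates that are conditioned on. -/
def Gap (μ : ∀ i, Measure (X i)) (p : (∀ i, X i) → ℝ≥0∞)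
    (δ : ∀ Γ : Finset ι, (∀ i : ↥(Γᶜ), X i) → (∀ i : ↥Γ, X i) → ℝ≥0∞) (m l : ℕ) : EReal :=
  ⨅ (Γ : Finset ι) (_ : Γ.card = m) (x : ∀ i, X i) (_ : Admissible μ p Γ x),
    spectralGap (condLaw μ p δ Γ x) (gibbsKernel μ p δ Γ x l)

/-- `S(m)`: the largest summation-based correlation coefficient of the components of the
`m`-dimensional conditional laws. -/
def corrSup (μ : ∀ i, Measure (X i)) (p : (∀ i, X i) → ℝ≥0∞)
    (δ : ∀ Γ : Finset ι, (∀ i : ↥(Γᶜ), X i) → (∀ i : ↥Γ, X i) → ℝ≥0∞) (m : ℕ) : ℝ≥0∞ :=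
  ⨆ (Γ : Finset ι) (_ : Γ.card = m) (x : ∀ i, X i) (_ : Admissible μ p Γ x),
    sumCorr (condLaw μ p δ Γ x)

end Gibbs

end

/-! ### Conditional expectations as kernels: the projection calculus in L². -/

section Conditioning

open ProbabilityTheory

variable {Ω : Type*} [MeasurableSpace Ω]

/-! Fix a set `Γ` of `m` free coordinates and a conditional law `ω` on it. Write `P_B` for redrawing
the coordinates in `B ⊆ Γ`: it is conditional expectation given the others, an orthogonal projection
of L²(ω). The Gibbs sampler of block size `l` is the average `A_l` of the `P_B` with `#B = l`, so it
is self-adjoint and positive. Its norm on mean-zero functions is therefore controlled by its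
quadratic form (`integral_kernelAverage_sq_le`), and a gap bound amounts to a Poincaré inequality `γ
Var f ≤ ‖f‖² - ⟪f, A_l f⟫`.

For `l = m - 1`, the function `P_{Γ∖i} f` depends on the free coordinate `i` alone. These `m`
functions are thus admissible in `s_*`, which gives `‖A f‖² ≤ s_* · m⁻¹ ∑ ‖P_{Γ∖i} f‖² = s_* ⟪f, A
f⟫`. Cauchy–Schwarz turns this into `⟪f, A f⟫ ≤ s_* ‖f‖²`
(`Admissible.integral_kernelAverage_erase_sq_le`, `integral_mul_kernelAverage_le`).

For smaller `l`, induct on `m` (`Admissible.poincare`). Given coordinate `i`, the inequality for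
`Γ∖i` bounds the conditional variance of `f`. Integrated and averaged over `i`, it compares the form
of `1 - A_l` with that of `1 - A_{m-1}`, and the case just treated contributes the factor `1 -
S(m)`. The inequalities are stated with variances because `f` need not be centred on the fibres. -/

/-- `κ` is a version of the conditional law under `ω` given a `σ`-algebra: it leaves `ω` invariant,
it is Markov almost everywhere, and `κ x` is carried by the fibre `{x' | κ x' = κ x}`. -/
structure IsConditioning (κ : Kernel Ω Ω) (ω : Measure Ω) : Prop where
  invariant : κ.Invariant ω
  prob : ∀ᵐ x ∂ω, IsProbabilityMeasure (κ x)
  const : ∀ x, ∀ᵐ x' ∂κ x, κ x' = κ x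

namespace IsConditioning

variable {κ : Kernel Ω Ω} {ω : Measure Ω} {f g : Ω → ℝ}

theorem ae_ae (h : IsConditioning κ ω) {q : Ω → Prop} (hq : ∀ᵐ x ∂ω, q x) :
    ∀ᵐ x ∂ω, ∀ᵐ x' ∂κ x, q x' := by
  refine Measure.ae_ae_of_ae_bind (f := κ) κ.aemeasurable ?_
  rwa [h.invariant.def]

theorem integrable_ae (h : IsConditioning κ ω) (hf : Integrable f ω) :
    ∀ᵐ x ∂ω, Integrable f (κ x) := by
  refine Measure.ae_integrable_of_integrable_comp (κ := κ) ?_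
  rwa [h.invariant.def]

theorem memLp_ae (h : IsConditioning κ ω) (hf : MemLp f 2 ω) :
    ∀ᵐ x ∂ω, MemLp f 2 (κ x) := by
  have h1 := h.integrable_ae hf.integrable_sq
  have hm : AEStronglyMeasurable f (ω.bind κ) := by rw [h.invariant.def]; exact hf.1
  have h2 : ∀ᵐ x ∂ω, AEStronglyMeasurable f (κ x) := by
    have := AEMeasurable.ae_of_bind (f := κ) κ.aemeasurable hm.aemeasurable
    filter_upwards [this] with x hx using hx.aestronglyMeasurable
  filter_upwards [h1, h2] with x hx1 hx2
  exact (memLp_two_iff_integrable_sq hx2).2 hx1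

theorem integrable_integral (h : IsConditioning κ ω) (hf : Integrable f ω) :
    Integrable (fun x => ∫ y, f y ∂κ x) ω := by
  -- Viewing `ω` as a kernel from a point makes the integrability and Fubini statements for composed
  -- kernels applicable.
  have hc : (κ ∘ₖ Kernel.const Unit ω) () = ω := by
    rw [← Measure.comp_eq_comp_const_apply, h.invariant.def]
  have hf' : Integrable f ((κ ∘ₖ Kernel.const Unit ω) ()) := by rwa [hc]
  simpa using hf'.integral_comp

theorem integral_integral (h : IsConditioning κ ω) (hf : Integrable f ω) :
    ∫ x, ∫ y, f y ∂κ x ∂ω = ∫ x, f x ∂ω := by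
  have hc : (κ ∘ₖ Kernel.const Unit ω) () = ω := by
    rw [← Measure.comp_eq_comp_const_apply, h.invariant.def]
  have hf' : Integrable f ((κ ∘ₖ Kernel.const Unit ω) ()) := by rwa [hc]
  have := Kernel.integral_comp hf'
  rw [hc] at this
  simpa using this.symm

theorem memLp_integral [IsFiniteMeasure ω] (h : IsConditioning κ ω) (hf : MemLp f 2 ω) :
    MemLp (fun x => ∫ y, f y ∂κ x) 2 ω := by
  have hi := h.integrable_integral (hf.integrable one_le_two)
  refine (memLp_two_iff_integrable_sq hi.1).2 ?_
  -- Jensen: the variance of `f` under `κ x` is nonnegative.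
  refine (h.integrable_integral hf.integrable_sq).mono' (hi.1.pow 2) ?_
  filter_upwards [h.prob, h.memLp_ae hf] with x hx hfx
  have := variance_eq_sub hfx
  have h0 := variance_nonneg f (κ x)
  rw [Real.norm_of_nonneg (sq_nonneg _)]
  simp only [Pi.pow_apply] at this
  linarith

/-- Disintegrate the left side along `κ`: on almost all of a fibre `∫ f dκ` is constant and can be
pulled out. This says `⟪g, P f⟫ = ⟪P g, P f⟫`, so it encodes at once that `P` is self-adjoint and
idempotent. -/
theorem integral_mul [IsFiniteMeasure ω] (h : IsConditioning κ ω) (hg : MemLp g 2 ω)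
    (hf : MemLp f 2 ω) :
    ∫ x, g x * ∫ y, f y ∂κ x ∂ω = ∫ x, (∫ y, g y ∂κ x) * ∫ y, f y ∂κ x ∂ω := by
  have hi : Integrable (fun x => g x * ∫ y, f y ∂κ x) ω := hg.integrable_mul (h.memLp_integral hf)
  rw [← h.integral_integral hi]
  congr 1 with x
  rw [← integral_mul_const]
  refine integral_congr_ae ?_
  filter_upwards [h.const x] with y hy
  rw [hy]

theorem ae_integral_sub_const [IsFiniteMeasure ω] (h : IsConditioning κ ω) (hf : MemLp f 2 ω)
    (c : ℝ) : ∀ᵐ x ∂ω, ∫ y, (f y - c) ∂κ x = (∫ y, f y ∂κ x) - c := by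
  filter_upwards [h.prob, h.integrable_ae (hf.integrable one_le_two)] with x hx hfx
  rw [integral_sub hfx (integrable_const c)]
  simp

end IsConditioning

/-! ### Averages of projections: quadratic form versus norm. -/

/-- The average of the operators `f ↦ ∫ f dκ(x, ·)` over a finite family of kernels. -/
noncomputable def kernelAverage {β : Type*} (κ : β → Kernel Ω Ω) (s : Finset β) (f : Ω → ℝ) (x : Ω) : ℝ :=
  (s.card : ℝ)⁻¹ * ∑ b ∈ s, ∫ y, f y ∂κ b x

section Average

variable {β : Type*} {κ : β → Kernel Ω Ω} {s : Finset β} {ω : Measure Ω} {f g : Ω → ℝ}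

theorem measurable_kernelAverage [∀ b, IsSFiniteKernel (κ b)] (hf : Measurable f) :
    Measurable (kernelAverage κ s f) :=
  (Finset.measurable_fun_sum _ fun b _ =>
    (hf.stronglyMeasurable.integral_kernel (κ := κ b)).measurable).const_mul _

theorem memLp_kernelAverage [IsFiniteMeasure ω] (h : ∀ b ∈ s, IsConditioning (κ b) ω)
    (hf : MemLp f 2 ω) : MemLp (kernelAverage κ s f) 2 ω :=
  (memLp_finsetSum s fun b hb => (h b hb).memLp_integral hf).const_mul _

theorem integral_mul_kernelAverage [IsFiniteMeasure ω] (h : ∀ b ∈ s, IsConditioning (κ b) ω)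
    (hg : MemLp g 2 ω) (hf : MemLp f 2 ω) :
    ∫ x, g x * kernelAverage κ s f x ∂ω =
      (s.card : ℝ)⁻¹ * ∑ b ∈ s, ∫ x, (∫ y, g y ∂κ b x) * ∫ y, f y ∂κ b x ∂ω := by
  have hi : ∀ b ∈ s, Integrable (fun x => g x * ∫ y, f y ∂κ b x) ω := fun b hb =>
    hg.integrable_mul ((h b hb).memLp_integral hf)
  calc ∫ x, g x * kernelAverage κ s f x ∂ω
      = ∫ x, (s.card : ℝ)⁻¹ * ∑ b ∈ s, g x * ∫ y, f y ∂κ b x ∂ω := by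
        congr 1 with x
        rw [kernelAverage, ← Finset.mul_sum]; ring
    _ = (s.card : ℝ)⁻¹ * ∑ b ∈ s, ∫ x, g x * ∫ y, f y ∂κ b x ∂ω := by
        rw [integral_const_mul, integral_finsetSum s hi]
    _ = _ := by
        congr 1
        exact Finset.sum_congr rfl fun b hb => (h b hb).integral_mul hg hf

theorem integral_kernelAverage [IsFiniteMeasure ω] (h : ∀ b ∈ s, IsConditioning (κ b) ω)
    (hs : s.Nonempty) (hf : MemLp f 2 ω) : ∫ x, kernelAverage κ s f x ∂ω = ∫ x, f x ∂ω := by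
  have hi : ∀ b ∈ s, Integrable (fun x => ∫ y, f y ∂κ b x) ω := fun b hb =>
    ((h b hb).memLp_integral hf).integrable one_le_two
  have hc : (s.card : ℝ) ≠ 0 := by exact_mod_cast hs.card_pos.ne'
  simp only [kernelAverage]
  rw [integral_const_mul, integral_finsetSum s hi,
    Finset.sum_congr rfl fun b hb => (h b hb).integral_integral (hf.integrable one_le_two)]
  simp [hc]

theorem ae_kernelAverage_sub_const [IsFiniteMeasure ω] (h : ∀ b ∈ s, IsConditioning (κ b) ω)
    (hs : s.Nonempty) (hf : MemLp f 2 ω) (c : ℝ) :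
    ∀ᵐ x ∂ω, kernelAverage κ s (fun y => f y - c) x = kernelAverage κ s f x - c := by
  have hc : (s.card : ℝ) ≠ 0 := by exact_mod_cast hs.card_pos.ne'
  have := (Filter.eventually_all_finset s).2 fun b hb => (h b hb).ae_integral_sub_const hf c
  filter_upwards [this] with x hx
  rw [kernelAverage, kernelAverage, Finset.sum_congr rfl hx, Finset.sum_sub_distrib, mul_sub]
  simp [hc]

theorem integral_mul_sub_sq (hf : MemLp f 2 ω) (hg : MemLp g 2 ω) (t : ℝ) :
    ∫ x, (t * f x - g x) ^ 2 ∂ω =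
      t ^ 2 * ∫ x, f x * f x ∂ω - 2 * t * ∫ x, g x * f x ∂ω + ∫ x, g x * g x ∂ω := by
  have e1 : Integrable (fun x => t ^ 2 * (f x * f x)) ω := (hf.integrable_mul hf).const_mul _
  have e2 : Integrable (fun x => 2 * t * (g x * f x)) ω := (hg.integrable_mul hf).const_mul _
  have e3 : Integrable (fun x => g x * g x) ω := hg.integrable_mul hg
  have e4 : Integrable (fun x => t ^ 2 * (f x * f x) - 2 * t * (g x * f x)) ω := e1.sub e2
  rw [← integral_const_mul, ← integral_const_mul, ← integral_sub e1 e2, ← integral_add e4 e3]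
  congr 1 with x
  ring

/-- A bound on the quadratic form of the average of conditional expectations bounds its norm. -/
theorem integral_kernelAverage_sq_le [IsFiniteMeasure ω] (h : ∀ b ∈ s, IsConditioning (κ b) ω)
    [∀ b, IsSFiniteKernel (κ b)] (hs : s.Nonempty) {c : ℝ} (hc : 0 ≤ c)
    (hq : ∀ f : Ω → ℝ, Measurable f → MemLp f 2 ω → ∫ x, f x ∂ω = 0 →
      ∫ x, f x * kernelAverage κ s f x ∂ω ≤ c * ∫ x, f x ^ 2 ∂ω)
    (hfm : Measurable f) (hf : MemLp f 2 ω) (hf0 : ∫ x, f x ∂ω = 0) :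
    ∫ x, kernelAverage κ s f x ^ 2 ∂ω ≤ c ^ 2 * ∫ x, f x ^ 2 ∂ω := by
  have hN : (0 : ℝ) < s.card := by exact_mod_cast hs.card_pos
  set g := kernelAverage κ s f with hg
  have hgL : MemLp g 2 ω := memLp_kernelAverage h hf
  have hg0 : ∫ x, g x ∂ω = 0 := by rw [hg, integral_kernelAverage h hs hf, hf0]
  have h1 := hq f hfm hf hf0
  have h2 := hq g (measurable_kernelAverage hfm) hgL hg0
  have h3 : ∫ x, g x ^ 2 ∂ω = ∫ x, g x * kernelAverage κ s f x ∂ω := by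
    simp only [← hg, sq]
  rw [integral_mul_kernelAverage h hf hf] at h1
  rw [integral_mul_kernelAverage h hgL hgL] at h2
  rw [integral_mul_kernelAverage h hgL hf] at h3
  -- Positivity of the form of `A` at `t f - g`, where `g = A f`; the cross term is `⟪g, A f⟫ =
  -- ‖g‖²`. With `t = c` and the form bounds for `f` and `g` it yields `c³‖f‖² - c‖g‖² ≥ 0`; for `c
  -- = 0`, `t = 1` already forces `g = 0`.
  have key : ∀ t : ℝ, 0 ≤ t ^ 2 * ((s.card : ℝ)⁻¹ * ∑ b ∈ s,
      ∫ x, (∫ y, f y ∂κ b x) * ∫ y, f y ∂κ b x ∂ω) - 2 * t * ((s.card : ℝ)⁻¹ * ∑ b ∈ s,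
      ∫ x, (∫ y, g y ∂κ b x) * ∫ y, f y ∂κ b x ∂ω) + ((s.card : ℝ)⁻¹ * ∑ b ∈ s,
      ∫ x, (∫ y, g y ∂κ b x) * ∫ y, g y ∂κ b x ∂ω) := by
    intro t
    have : 0 ≤ (s.card : ℝ)⁻¹ * ∑ b ∈ s,
        ∫ x, (t * (∫ y, f y ∂κ b x) - ∫ y, g y ∂κ b x) ^ 2 ∂ω :=
      mul_nonneg (by positivity) (Finset.sum_nonneg fun b _ => integral_nonneg fun x => sq_nonneg _)
    refine this.trans_eq ?_
    rw [mul_left_comm, mul_left_comm (2 * t), ← mul_sub, ← mul_add]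
    congr 1
    rw [Finset.mul_sum, Finset.mul_sum, ← Finset.sum_sub_distrib, ← Finset.sum_add_distrib]
    refine Finset.sum_congr rfl fun b hb => ?_
    have hF := (h b hb).memLp_integral hf
    have hG := (h b hb).memLp_integral hgL
    exact integral_mul_sub_sq hF hG t
  rw [← h3] at key
  rcases hc.eq_or_lt with rfl | hc
  · have := key 1
    nlinarith
  · have := key c
    have h4 : c * (c ^ 2 * ∫ x, f x ^ 2 ∂ω - ∫ x, g x ^ 2 ∂ω) ≥ 0 := by nlinarith [sq_nonneg c]
    linarith [(mul_nonneg_iff_of_pos_left hc).1 h4]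

/-- If `‖A f‖² ≤ c ⟪f, A f⟫` then `⟪f, A f⟫ ≤ c ‖f‖²`, for `A` an average of conditional
expectations. -/
theorem integral_mul_kernelAverage_le [IsFiniteMeasure ω] (h : ∀ b ∈ s, IsConditioning (κ b) ω)
    {c : ℝ} (hc : 0 ≤ c) (hf : MemLp f 2 ω)
    (hq : ∫ x, kernelAverage κ s f x ^ 2 ∂ω ≤ c * ∫ x, f x * kernelAverage κ s f x ∂ω) :
    ∫ x, f x * kernelAverage κ s f x ∂ω ≤ c * ∫ x, f x ^ 2 ∂ω := by
  set g := kernelAverage κ s f with hg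
  have hgL : MemLp g 2 ω := memLp_kernelAverage h hf
  have ha : 0 ≤ ∫ x, f x * g x ∂ω := by
    rw [hg, integral_mul_kernelAverage h hf hf]
    exact mul_nonneg (by positivity) (Finset.sum_nonneg fun b _ => integral_nonneg fun x =>
      mul_self_nonneg _)
  set a := ∫ x, f x * g x ∂ω
  -- Expansion of `‖f - t g‖² ≥ 0`, to be used at `t = 1/c`. If `c = 0` the quadratic term vanishes,
  -- and a large `t` excludes `a > 0`.
  have key : ∀ t : ℝ, 0 ≤ ∫ x, f x ^ 2 ∂ω - 2 * t * a + t ^ 2 * ∫ x, g x ^ 2 ∂ω := by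
    intro t
    have : 0 ≤ ∫ x, (f x - t * g x) ^ 2 ∂ω := integral_nonneg fun x => sq_nonneg _
    have h1 := integral_mul_sub_sq hgL hf t
    simp only [← sq] at h1
    have h2 : ∫ x, (t * g x - f x) ^ 2 ∂ω = ∫ x, (f x - t * g x) ^ 2 ∂ω := by
      congr 1 with x; ring
    linarith
  rcases hc.eq_or_lt with rfl | hc
  · by_contra! hlt
    rw [zero_mul] at hlt hq
    have := key (((∫ x, f x ^ 2 ∂ω) + 1) / a)
    have h2 : ((∫ x, f x ^ 2 ∂ω) + 1) / a * a = (∫ x, f x ^ 2 ∂ω) + 1 := by field_simp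
    have h3 : 0 ≤ ∫ x, f x ^ 2 ∂ω := integral_nonneg fun x => sq_nonneg _
    nlinarith [sq_nonneg (((∫ x, f x ^ 2 ∂ω) + 1) / a)]
  · have := key c⁻¹
    have h1 : c⁻¹ ^ 2 * ∫ x, g x ^ 2 ∂ω ≤ c⁻¹ ^ 2 * (c * a) :=
      mul_le_mul_of_nonneg_left hq (by positivity)
    have h2 : c⁻¹ ^ 2 * (c * a) = c⁻¹ * a := by field_simp
    have h3 : c⁻¹ * a ≤ ∫ x, f x ^ 2 ∂ω := by linarith
    rwa [inv_mul_le_iff₀ hc] at h3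

end Average

end Conditioning

/-! ### The conditional laws of a density, as kernels on the full product. -/

section CondKernel

open ProbabilityTheory

variable {ι : Type*} {X : ι → Type*}

theorem measurable_restrict_finset [∀ i, MeasurableSpace (X i)] (s : Finset ι) :
    Measurable (Finset.restrict s : (∀ i, X i) → ∀ i : s, X i) :=
  measurable_pi_lambda _ fun _ => measurable_pi_apply _

theorem updateFinset_congr_compl [DecidableEq ι] {Γ : Finset ι} {x y : ∀ i, X i} (h : ∀ i ∉ Γ, x i = y i)
    (w : ∀ i : ↥Γ, X i) : Function.updateFinset x Γ w = Function.updateFinset y Γ w := by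
  ext i
  by_cases hi : i ∈ Γ <;> simp [Function.updateFinset, hi, h]

variable [DecidableEq ι] [∀ i, MeasurableSpace (X i)]

theorem lintegral_smul_map_withDensity_updateFinset (μ : ∀ i, Measure (X i))
    {p : (∀ i, X i) → ℝ≥0∞} (hp : Measurable p) (Γ : Finset ι) (x : ∀ i, X i) (c : ℝ≥0∞)
    {G : (∀ i, X i) → ℝ≥0∞} (hG : Measurable G) :
    ∫⁻ y, G y ∂(c • ((Measure.pi fun i : ↥Γ => μ i).withDensity
      fun w => p (Function.updateFinset x Γ w)).map (Function.updateFinset x Γ)) =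
    c * (∫⋯∫⁻_Γ, (fun y => p y * G y) ∂μ) x := by
  have hm : Measurable (Function.updateFinset x Γ) := measurable_updateFinset
  rw [lintegral_smul_measure, lintegral_map hG hm, smul_eq_mul]
  exact congrArg (c * ·) (lintegral_withDensity_eq_lintegral_mul _ (hp.comp hm) (hG.comp hm))

theorem lmarginal_mul_of_congr (μ : ∀ i, Measure (X i)) {Γ : Finset ι} 
    {G H : (∀ i, X i) → ℝ≥0∞} (hG : Measurable G)
    (hH : ∀ x y : ∀ i, X i, (∀ i ∉ Γ, x i = y i) → H x = H y) (x : ∀ i, X i) :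
    (∫⋯∫⁻_Γ, (fun y => G y * H y) ∂μ) x = (∫⋯∫⁻_Γ, G ∂μ) x * H x := by
  have : ∀ w, H (Function.updateFinset x Γ w) = H x := fun w =>
    hH _ _ fun i hi => by simp [Function.updateFinset, hi]
  simp only [lmarginal, this]
  exact lintegral_mul_const _ (hG.comp measurable_updateFinset)

variable (μ : ∀ i, Measure (X i)) [∀ i, SigmaFinite (μ i)] {p : (∀ i, X i) → ℝ≥0∞}

/-- The law of all the coordinates when those in `Γ` are redrawn from their conditional law
given the other ones. It is `0` at the points where the conditional law is not determined. -/
noncomputable def condKernel (hp : Measurable p) (Γ : Finset ι) :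
    Kernel (∀ i, X i) (∀ i, X i) where
  toFun x := ((∫⋯∫⁻_Γ, p ∂μ) x)⁻¹ • ((Measure.pi fun i : ↥Γ => μ i).withDensity
      fun w => p (Function.updateFinset x Γ w)).map (Function.updateFinset x Γ)
  -- The mass of a set is a quotient of marginals, hence measurable in `x`. The value `0` at
  -- inadmissible points is what allows this: the default densities `δ` need not be measurable in
  -- the conditioning point.
  measurable' := by
    refine Measure.measurable_of_measurable_coe _ fun s hs => ?_
    have h1 : Measurable (s.indicator (1 : (∀ i, X i) → ℝ≥0∞)) := measurable_one.indicator hs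
    have : ∀ x, (((∫⋯∫⁻_Γ, p ∂μ) x)⁻¹ • ((Measure.pi fun i : ↥Γ => μ i).withDensity
        fun w => p (Function.updateFinset x Γ w)).map (Function.updateFinset x Γ)) s =
        ((∫⋯∫⁻_Γ, p ∂μ) x)⁻¹ * (∫⋯∫⁻_Γ, (fun y => p y * s.indicator 1 y) ∂μ) x := fun x => by
      rw [← lintegral_smul_map_withDensity_updateFinset μ hp Γ x _ h1, lintegral_indicator_one hs]
    simp only [this]
    exact ((hp.lmarginal μ).inv).mul ((hp.mul h1).lmarginal μ)

theorem condKernel_apply (hp : Measurable p) (Γ : Finset ι) (x : ∀ i, X i) :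
    condKernel μ hp Γ x = ((∫⋯∫⁻_Γ, p ∂μ) x)⁻¹ • ((Measure.pi fun i : ↥Γ => μ i).withDensity
      fun w => p (Function.updateFinset x Γ w)).map (Function.updateFinset x Γ) := rfl

variable {μ}

theorem lintegral_condKernel (hp : Measurable p) (Γ : Finset ι) (x : ∀ i, X i)
    {G : (∀ i, X i) → ℝ≥0∞} (hG : Measurable G) :
    ∫⁻ y, G y ∂condKernel μ hp Γ x =
      ((∫⋯∫⁻_Γ, p ∂μ) x)⁻¹ * (∫⋯∫⁻_Γ, (fun y => p y * G y) ∂μ) x :=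
  lintegral_smul_map_withDensity_updateFinset μ hp Γ x _ hG

theorem condKernel_univ (hp : Measurable p) (Γ : Finset ι) (x : ∀ i, X i) :
    condKernel μ hp Γ x Set.univ = ((∫⋯∫⁻_Γ, p ∂μ) x)⁻¹ * (∫⋯∫⁻_Γ, p ∂μ) x := by
  rw [← lintegral_one, lintegral_condKernel hp Γ x measurable_const]
  simp

theorem condKernel_univ_le (hp : Measurable p) (Γ : Finset ι) (x : ∀ i, X i) :
    condKernel μ hp Γ x Set.univ ≤ 1 := by
  rw [condKernel_univ]; exact ENNReal.inv_mul_le_one _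

instance (hp : Measurable p) (Γ : Finset ι) : IsFiniteKernel (condKernel μ hp Γ) :=
  ⟨1, ENNReal.one_lt_top, condKernel_univ_le hp Γ⟩

theorem condKernel_univ_eq_one_iff (hp : Measurable p) (Γ : Finset ι) (x : ∀ i, X i) :
    condKernel μ hp Γ x Set.univ = 1 ↔ Admissible μ p Γ x := by
  rw [condKernel_univ, Admissible]
  constructor
  · intro h
    refine ⟨pos_iff_ne_zero.2 fun h0 => ?_, lt_top_iff_ne_top.2 fun h0 => ?_⟩ <;> simp [h0] at h
  · rintro ⟨h0, h1⟩
    exact ENNReal.inv_mul_cancel h0.ne' h1.ne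

theorem Admissible.isProbabilityMeasure (hp : Measurable p) {Γ : Finset ι} {x : ∀ i, X i}
    (h : Admissible μ p Γ x) : IsProbabilityMeasure (condKernel μ hp Γ x) :=
  ⟨(condKernel_univ_eq_one_iff hp Γ x).2 h⟩

theorem condKernel_congr (hp : Measurable p) {Γ : Finset ι} {x y : ∀ i, X i}
    (h : ∀ i ∉ Γ, x i = y i) : condKernel μ hp Γ x = condKernel μ hp Γ y := by
  have : Function.updateFinset x Γ = Function.updateFinset y Γ :=
    funext fun w => updateFinset_congr_compl h w
  rw [condKernel_apply, condKernel_apply, lmarginal_congr μ p h, this]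

theorem ae_condKernel_eq [Fintype ι] [∀ i, MeasurableSingletonClass (X i)] (hp : Measurable p) (Γ : Finset ι)
    (x : ∀ i, X i) : ∀ᵐ y ∂condKernel μ hp Γ x, ∀ i ∉ Γ, y i = x i := by
  have hs : MeasurableSet {y : ∀ i, X i | ∀ i ∉ Γ, y i = x i} := by
    simp only [Set.ofPred_forall]
    exact MeasurableSet.iInter fun i => MeasurableSet.iInter fun _ =>
      (measurable_pi_apply i) (measurableSet_singleton (x i))
  rw [condKernel_apply]
  refine Measure.ae_smul_measure ?_ _
  rw [ae_map_iff measurable_updateFinset.aemeasurable hs]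
  exact Filter.Eventually.of_forall fun w i hi => by simp [Function.updateFinset, hi]

/-- Tower property, by Fubini over `Γ \ B` and `B`: the inner average does not depend on the
coordinates in `B`, so `p` integrates to its marginal, which cancels the normalisation. Where the
marginal is `0`, `p` vanishes almost everywhere on the fibre; where it is `∞`, the points are
negligible because the integral over `Γ` is finite. -/
theorem Admissible.lintegral_lintegral_condKernel (hp : Measurable p) {B Γ : Finset ι} (hB : B ⊆ Γ)
    {x : ∀ i, X i} (h : Admissible μ p Γ x) {G : (∀ i, X i) → ℝ≥0∞} (hG : Measurable G) :
    ∫⁻ y, ∫⁻ z, G z ∂condKernel μ hp B y ∂condKernel μ hp Γ x = ∫⁻ z, G z ∂condKernel μ hp Γ x := by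
  rw [lintegral_condKernel hp Γ x hG.lintegral_kernel, lintegral_condKernel hp Γ x hG]
  congr 1
  have hpG : Measurable fun y => p y * G y := hp.mul hG
  have hpI : Measurable fun y => p y * ∫⁻ z, G z ∂condKernel μ hp B y :=
    hp.mul hG.lintegral_kernel
  rw [← Finset.sdiff_union_of_subset hB, lmarginal_union μ _ hpI Finset.sdiff_disjoint,
    lmarginal_union μ _ hpG Finset.sdiff_disjoint]
  have hfin : ∀ᵐ w ∂(Measure.pi fun i : ↥(Γ \ B) => μ i),
      (∫⋯∫⁻_B, p ∂μ) (Function.updateFinset x (Γ \ B) w) < ∞ := by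
    refine ae_lt_top ((hp.lmarginal μ).comp measurable_updateFinset) ?_
    have := h.2
    rw [← Finset.sdiff_union_of_subset hB, lmarginal_union μ _ hp Finset.sdiff_disjoint] at this
    exact this.ne
  refine lintegral_congr_ae ?_
  filter_upwards [hfin] with w hw
  set y := Function.updateFinset x (Γ \ B) w
  rw [lmarginal_mul_of_congr μ hp fun a b hab => by rw [condKernel_congr hp hab],
    lintegral_condKernel hp B y hG, ← mul_assoc]
  rcases eq_or_ne ((∫⋯∫⁻_B, p ∂μ) y) 0 with h0 | h0
  · rw [h0, zero_mul, zero_mul]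
    have hz : (fun w => p (Function.updateFinset y B w)) =ᵐ[Measure.pi fun i : ↥B => μ i] 0 :=
      (lintegral_eq_zero_iff (hp.comp measurable_updateFinset)).1 h0
    refine ((lintegral_eq_zero_iff (hpG.comp measurable_updateFinset)).2 ?_).symm
    filter_upwards [hz] with v hv
    simp only [Pi.zero_apply] at hv
    simp [hv]
  · rw [ENNReal.mul_inv_cancel h0 hw.ne, one_mul]

theorem Admissible.invariant_condKernel (hp : Measurable p) {B Γ : Finset ι} (hB : B ⊆ Γ)
    {x : ∀ i, X i} (h : Admissible μ p Γ x) :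
    (condKernel μ hp B).Invariant (condKernel μ hp Γ x) := by
  refine Measure.ext fun s hs => ?_
  rw [Measure.bind_apply hs (condKernel μ hp B).aemeasurable]
  have := h.lintegral_lintegral_condKernel hp hB (measurable_one.indicator hs)
  simpa only [lintegral_indicator_one hs] using this

/-- The total masses of `condKernel μ hp B y` are at most `1` and average to `1`, so almost all
equal `1`. Hence the default densities `δ` are never seen. -/
theorem Admissible.ae_admissible (hp : Measurable p) {B Γ : Finset ι} (hB : B ⊆ Γ)
    {x : ∀ i, X i} (h : Admissible μ p Γ x) :
    ∀ᵐ y ∂condKernel μ hp Γ x, Admissible μ p B y := by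
  have := h.isProbabilityMeasure hp
  simp only [← condKernel_univ_eq_one_iff hp]
  have h1 := h.lintegral_lintegral_condKernel hp hB measurable_one
  simp only [Pi.one_apply, lintegral_one, measure_univ] at h1
  have h2 : ∫⁻ y, (1 - condKernel μ hp B y Set.univ) ∂condKernel μ hp Γ x = 0 := by
    rw [lintegral_sub ((condKernel μ hp B).measurable_coe MeasurableSet.univ) (by simp [h1])
      (Filter.Eventually.of_forall (condKernel_univ_le hp B)), h1]
    simp
  have hm : Measurable fun y => 1 - condKernel μ hp B y Set.univ :=
    measurable_const.sub ((condKernel μ hp B).measurable_coe MeasurableSet.univ)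
  rw [lintegral_eq_zero_iff hm] at h2
  filter_upwards [h2] with y hy
  exact le_antisymm (condKernel_univ_le hp B y) (tsub_eq_zero_iff_le.1 hy)

theorem Admissible.isConditioning [Fintype ι] [∀ i, MeasurableSingletonClass (X i)] (hp : Measurable p)
    {B Γ : Finset ι} (hB : B ⊆ Γ) {x : ∀ i, X i} (h : Admissible μ p Γ x) :
    IsConditioning (condKernel μ hp B) (condKernel μ hp Γ x) where
  invariant := h.invariant_condKernel hp hB
  prob := (h.ae_admissible hp hB).mono fun _ hy => hy.isProbabilityMeasure hp
  const y := (ae_condKernel_eq hp B y).mono fun _ hz => condKernel_congr hp hz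

end CondKernel

/-! ### The summation-based correlation coefficient. -/

section SumCorr

variable {κ : Type*} [Fintype κ] {Y : κ → Type*} [∀ k, MeasurableSpace (Y k)]
  {ω : Measure (∀ k, Y k)} {f : ∀ k, Y k → ℝ}

theorem lintegral_sq_sum_le
    (hf : ∀ k, AEStronglyMeasurable (f k) (ω.map fun y => y k)) :
    ∫⁻ y, ENNReal.ofReal ((∑ k, f k (y k)) ^ 2) ∂ω ≤
      (Fintype.card κ : ℝ≥0∞) * ∑ k, ∫⁻ y, ENNReal.ofReal ((f k (y k)) ^ 2) ∂ω := by
  have hm : ∀ k, AEMeasurable (fun y => ENNReal.ofReal ((f k (y k)) ^ 2)) ω := fun k =>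
    (((hf k).comp_measurable (measurable_pi_apply k)).aemeasurable.pow_const 2).ennreal_ofReal
  rw [← lintegral_finsetSum' _ fun k _ => hm k,
    ← lintegral_const_mul'' _ (Finset.aemeasurable_fun_sum _ fun k _ => hm k)]
  refine lintegral_mono fun y => ?_
  rw [← ENNReal.ofReal_sum_of_nonneg fun k _ => sq_nonneg _, ← ENNReal.ofReal_natCast,
    ← ENNReal.ofReal_mul (by positivity)]
  exact ENNReal.ofReal_le_ofReal sq_sum_le_card_mul_sum_sq

theorem sumCorr_le_one : sumCorr ω ≤ 1 := by
  refine iSup_le fun f => iSup_le fun hf => iSup_le fun _ => ?_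
  refine ENNReal.div_le_of_le_mul ?_
  rw [one_mul]
  exact lintegral_sq_sum_le fun k => (hf k).1.1

theorem lintegral_sq_sum_le_sumCorr_mul
    (hf : ∀ k, MemLp (f k) 2 (ω.map (fun y => y k)) ∧ ∫ t, f k t ∂(ω.map (fun y => y k)) = 0) :
    ∫⁻ y, ENNReal.ofReal ((∑ k, f k (y k)) ^ 2) ∂ω ≤ sumCorr ω *
      ((Fintype.card κ : ℝ≥0∞) * ∑ k, ∫⁻ y, ENNReal.ofReal ((f k (y k)) ^ 2) ∂ω) := by
  by_cases h : ∃ k, 0 < ∫⁻ y, ENNReal.ofReal ((f k (y k)) ^ 2) ∂ω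
  · have hle : (∫⁻ y, ENNReal.ofReal ((∑ k, f k (y k)) ^ 2) ∂ω) /
        ((Fintype.card κ : ℝ≥0∞) * ∑ k, ∫⁻ y, ENNReal.ofReal ((f k (y k)) ^ 2) ∂ω) ≤ sumCorr ω :=
      le_iSup_of_le f (le_iSup_of_le hf (le_iSup_of_le h le_rfl))
    refine (ENNReal.div_le_iff_le_mul (Or.inl ?_) (Or.inl ?_)).1 hle
    · obtain ⟨k, hk⟩ := h
      have : Nonempty κ := ⟨k⟩
      refine mul_ne_zero (by simp) fun h0 => hk.ne' ?_
      exact (Finset.sum_eq_zero_iff.1 h0) k (Finset.mem_univ k)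
    · refine ENNReal.mul_ne_top (by simp) (ENNReal.sum_ne_top.2 fun k _ => ?_)
      have h1 : Integrable (fun y => f k (y k) ^ 2) ω := by
        have := (hf k).1.integrable_sq
        exact this.comp_measurable (measurable_pi_apply k)
      rw [← ofReal_integral_eq_lintegral_ofReal h1 (Filter.Eventually.of_forall fun _ => sq_nonneg _)]
      exact ENNReal.ofReal_ne_top
  -- If all the `f k` vanish almost surely they do not enter the supremum, but then the
  -- Cauchy–Schwarz bound is already `0`.
  · push Not at h
    refine (lintegral_sq_sum_le fun k => (hf k).1.1).trans ?_
    simp [fun k => le_antisymm (h k) bot_le]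

end SumCorr

/-- Discarding a uniform point and then choosing a uniform `l`-subset of the rest gives a uniform
`l`-subset: each `B` arises from the `m + 1 - l` points outside it. -/
theorem inv_card_mul_sum_erase_powersetCard {ι : Type*} [DecidableEq ι] {Γ : Finset ι} {l m : ℕ}
    (hΓ : Γ.card = m + 1) (hl : l ≤ m) (a : Finset ι → ℝ) :
    (Γ.card : ℝ)⁻¹ * ∑ i ∈ Γ, (((Γ.erase i).powersetCard l).card : ℝ)⁻¹ *
        ∑ B ∈ (Γ.erase i).powersetCard l, a B =
      ((Γ.powersetCard l).card : ℝ)⁻¹ * ∑ B ∈ Γ.powersetCard l, a B := by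
  have h1 : ∑ i ∈ Γ, (((Γ.erase i).powersetCard l).card : ℝ)⁻¹ *
      ∑ B ∈ (Γ.erase i).powersetCard l, a B =
      (m.choose l : ℝ)⁻¹ * ∑ i ∈ Γ, ∑ B ∈ (Γ.erase i).powersetCard l, a B := by
    rw [Finset.mul_sum]
    refine Finset.sum_congr rfl fun i hi => ?_
    rw [Finset.card_powersetCard, Finset.card_erase_of_mem hi, hΓ, Nat.add_sub_cancel]
  have h2 : ∑ i ∈ Γ, ∑ B ∈ (Γ.erase i).powersetCard l, a B =
      ∑ B ∈ Γ.powersetCard l, ∑ _i ∈ Γ \ B, a B := by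
    refine Finset.sum_comm' fun i B => ?_
    simp only [Finset.mem_powersetCard, Finset.mem_sdiff, Finset.subset_erase]
    tauto
  have h3 : ∑ B ∈ Γ.powersetCard l, ∑ _i ∈ Γ \ B, a B =
      ((m + 1 - l : ℕ) : ℝ) * ∑ B ∈ Γ.powersetCard l, a B := by
    rw [Finset.mul_sum]
    refine Finset.sum_congr rfl fun B hB => ?_
    obtain ⟨hB1, hB2⟩ := Finset.mem_powersetCard.1 hB
    rw [Finset.sum_const, Finset.card_sdiff_of_subset hB1, hΓ, hB2, nsmul_eq_mul]
  rw [h1, h2, h3, Finset.card_powersetCard, hΓ, ← mul_assoc, ← mul_assoc]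
  congr 1
  have h4 : (m.choose l : ℝ) * ((m + 1 : ℕ) : ℝ) = (m + 1).choose l * ((m + 1 - l : ℕ) : ℝ) := by
    exact_mod_cast Nat.choose_mul_succ_eq m l
  have h5 : (m.choose l : ℝ) ≠ 0 := by exact_mod_cast (Nat.choose_pos hl).ne'
  have h6 : ((m + 1).choose l : ℝ) ≠ 0 := by exact_mod_cast (Nat.choose_pos (by omega)).ne'
  field_simp
  linarith

/-! ### Poincaré inequalities for the Gibbs samplers. -/

section Gibbs

open ProbabilityTheory

variable {ι : Type*} [Fintype ι] [DecidableEq ι] {X : ι → Type*} [∀ i, MeasurableSpace (X i)]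
  {μ : ∀ i, Measure (X i)} [∀ i, SigmaFinite (μ i)] {p : (∀ i, X i) → ℝ≥0∞}
  (δ : ∀ Γ : Finset ι, (∀ i : ↥(Γᶜ), X i) → (∀ i : ↥Γ, X i) → ℝ≥0∞)

theorem Admissible.map_condLaw (hp : Measurable p) {Γ : Finset ι} {x : ∀ i, X i}
    (h : Admissible μ p Γ x) :
    (condLaw μ p δ Γ x).map (Function.updateFinset x Γ) = condKernel μ hp Γ x := by
  have h1 : condDensity μ p δ Γ x =
      ((∫⋯∫⁻_Γ, p ∂μ) x)⁻¹ • fun w => p (Function.updateFinset x Γ w) := by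
    ext w
    simp [condDensity, h, ENNReal.div_eq_inv_mul]
  have h2 : Measurable fun w => p (Function.updateFinset x Γ w) := hp.comp measurable_updateFinset
  rw [condLaw, h1, withDensity_smul _ h2, Measure.map_smul, condKernel_apply]

theorem Admissible.map_condKernel (hp : Measurable p) {Γ : Finset ι} {x : ∀ i, X i}
    (h : Admissible μ p Γ x) :
    (condKernel μ hp Γ x).map (Finset.restrict Γ) = condLaw μ p δ Γ x := by
  rw [← h.map_condLaw δ hp, Measure.map_map (measurable_restrict_finset Γ) measurable_updateFinset]
  have : Finset.restrict Γ ∘ Function.updateFinset x Γ = id :=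
    funext fun w => Function.restrict_updateFinset x w
  rw [this, Measure.map_id]

theorem updateFinset_eq_update_of_notMem_erase {ι : Type*} [DecidableEq ι] {X : ι → Type*}
    (x : ∀ i, X i) (Γ : Finset ι) (z : ∀ i : ↥Γ, X i) (k : ↥Γ) (i : ι) (hi : i ∉ Γ.erase k) :
    Function.updateFinset x Γ z i = Function.update x (k : ι) (z k) i := by
  rcases eq_or_ne i k with rfl | hik
  · simp [Function.updateFinset]
  · have : i ∉ Γ := fun h => hi (Finset.mem_erase.2 ⟨hik, h⟩)
    simp [Function.updateFinset, this, hik]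

variable [∀ i, MeasurableSingletonClass (X i)]

/-- The definition of `sumCorr` is tested on the conditional expectations of `f` given single
coordinates; the sum of their squared norms is `Γ.card` times the quadratic form of the average. -/
theorem Admissible.integral_kernelAverage_erase_sq_le (hp : Measurable p) {Γ : Finset ι}
    (hΓ : Γ.Nonempty) {x : ∀ i, X i} (h : Admissible μ p Γ x) {f : (∀ i, X i) → ℝ}
    (hfm : Measurable f) (hf : MemLp f 2 (condKernel μ hp Γ x))
    (hf0 : ∫ y, f y ∂condKernel μ hp Γ x = 0) :
    ∫ y, kernelAverage (fun i => condKernel μ hp (Γ.erase i)) Γ f y ^ 2 ∂condKernel μ hp Γ x ≤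
      (sumCorr (condLaw μ p δ Γ x)).toReal *
      ∫ y, f y * kernelAverage (fun i => condKernel μ hp (Γ.erase i)) Γ f y
        ∂condKernel μ hp Γ x := by
  have hprob := h.isProbabilityMeasure hp
  have hcond : ∀ i ∈ Γ, IsConditioning (condKernel μ hp (Γ.erase i)) (condKernel μ hp Γ x) :=
    fun i _ => h.isConditioning hp (Finset.erase_subset i Γ)
  have hU : Measurable (Function.updateFinset x Γ) := measurable_updateFinset
  have hmap := h.map_condLaw δ hp
  set ω := condKernel μ hp Γ x
  set ν := condLaw μ p δ Γ x
  let P : ↥Γ → (∀ i, X i) → ℝ := fun k y => ∫ z, f z ∂condKernel μ hp (Γ.erase k) y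
  -- `P k` ignores the coordinates in `Γ.erase k`, so on the fibre through `x` it is a function of
  -- coordinate `k` only.
  let g : ∀ k : ↥Γ, X k → ℝ := fun k t => P k (Function.update x k t)
  have hPm : ∀ k, Measurable (P k) := fun k =>
    (hfm.stronglyMeasurable.integral_kernel (κ := condKernel μ hp (Γ.erase k))).measurable
  have hgP : ∀ k z, g k (z k) = P k (Function.updateFinset x Γ z) := fun k z => by
    simp only [g, P]
    rw [condKernel_congr hp fun i hi =>
      (updateFinset_eq_update_of_notMem_erase x Γ z k i hi).symm]
  have hgm : ∀ k, Measurable (g k) := fun k => (hPm k).comp (measurable_update x)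
  have hPL : ∀ k, MemLp (P k) 2 ω := fun k => (hcond k k.2).memLp_integral hf
  have hg : ∀ k, MemLp (g k) 2 (ν.map (fun y => y k)) ∧ ∫ t, g k t ∂(ν.map (fun y => y k)) = 0 := by
    intro k
    constructor
    · rw [memLp_map_measure_iff (hgm k).aestronglyMeasurable (measurable_pi_apply k).aemeasurable]
      have := hPL k
      rw [← hmap, memLp_map_measure_iff (hPm k).aestronglyMeasurable hU.aemeasurable] at this
      exact this.congr_norm ((hgm k).comp (measurable_pi_apply k)).aestronglyMeasurable
        (Filter.Eventually.of_forall fun z => by simp [hgP])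
    · rw [integral_map (measurable_pi_apply k).aemeasurable (hgm k).aestronglyMeasurable]
      simp only [hgP]
      rw [← integral_map hU.aemeasurable (hPm k).aestronglyMeasurable, hmap,
        (hcond k k.2).integral_integral (hf.integrable one_le_two), hf0]
  have key := lintegral_sq_sum_le_sumCorr_mul hg
  have hlint : ∀ q : (∀ i, X i) → ℝ, Measurable q → MemLp q 2 ω →
      ∫⁻ z, ENNReal.ofReal (q (Function.updateFinset x Γ z) ^ 2) ∂ν =
        ENNReal.ofReal (∫ y, q y ^ 2 ∂ω) := by
    intro q hqm hq
    rw [ofReal_integral_eq_lintegral_ofReal hq.integrable_sq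
      (Filter.Eventually.of_forall fun _ => sq_nonneg _), ← hmap,
      lintegral_map (hqm.pow_const 2).ennreal_ofReal hU]
  simp only [hgP] at key
  rw [hlint (fun y => ∑ k, P k y) (Finset.measurable_fun_sum _ fun k _ => hPm k)
      (memLp_finsetSum _ fun k _ => hPL k),
    Finset.sum_congr rfl fun k _ => hlint (P k) (hPm k) (hPL k),
    ← ENNReal.ofReal_sum_of_nonneg fun k _ => integral_nonneg fun y => sq_nonneg _,
    ← ENNReal.ofReal_natCast, ← ENNReal.ofReal_mul (by positivity),
    ← ENNReal.ofReal_toReal (a := sumCorr ν)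
      (ne_top_of_le_ne_top ENNReal.one_ne_top sumCorr_le_one),
    ← ENNReal.ofReal_mul ENNReal.toReal_nonneg, ENNReal.ofReal_le_ofReal_iff
      (mul_nonneg ENNReal.toReal_nonneg (mul_nonneg (by positivity)
        (Finset.sum_nonneg fun k _ => integral_nonneg fun y => sq_nonneg _)))] at key
  have hN : (0 : ℝ) < Γ.card := by exact_mod_cast hΓ.card_pos
  rw [integral_mul_kernelAverage hcond hf hf]
  have e1 : ∀ y, kernelAverage (fun i => condKernel μ hp (Γ.erase i)) Γ f y =
      (Γ.card : ℝ)⁻¹ * ∑ k, P k y := fun y => by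
    rw [kernelAverage, ← Finset.sum_coe_sort Γ]
  have e2 : ∑ k, ∫ y, P k y ^ 2 ∂ω = ∑ i ∈ Γ, ∫ y, (∫ z, f z ∂condKernel μ hp (Γ.erase i) y) *
      ∫ z, f z ∂condKernel μ hp (Γ.erase i) y ∂ω := by
    rw [← Finset.sum_coe_sort Γ]
    simp only [P, sq]
  rw [e2, Fintype.card_coe] at key
  simp only [e1, mul_pow]
  rw [integral_const_mul]
  have := mul_le_mul_of_nonneg_left key (sq_nonneg (Γ.card : ℝ)⁻¹)
  refine this.trans_eq ?_
  field_simp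

/-- The Poincaré inequality for the Gibbs sampler that redraws all coordinates but one. -/
theorem Admissible.poincare_erase (hp : Measurable p) {Γ : Finset ι}
    (hΓ : Γ.Nonempty) {x : ∀ i, X i} (h : Admissible μ p Γ x) {f : (∀ i, X i) → ℝ}
    (hfm : Measurable f) (hf : MemLp f 2 (condKernel μ hp Γ x)) :
    (1 - (sumCorr (condLaw μ p δ Γ x)).toReal) *
        (∫ y, f y ^ 2 ∂condKernel μ hp Γ x - (∫ y, f y ∂condKernel μ hp Γ x) ^ 2) ≤
      ∫ y, f y ^ 2 ∂condKernel μ hp Γ x -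
        ∫ y, f y * kernelAverage (fun i => condKernel μ hp (Γ.erase i)) Γ f y
          ∂condKernel μ hp Γ x := by
  have hprob := h.isProbabilityMeasure hp
  have hcond : ∀ i ∈ Γ, IsConditioning (condKernel μ hp (Γ.erase i)) (condKernel μ hp Γ x) :=
    fun i _ => h.isConditioning hp (Finset.erase_subset i Γ)
  set c := ∫ y, f y ∂condKernel μ hp Γ x with hc
  have hfi := hf.integrable one_le_two
  have hf' : MemLp (fun y => f y - c) 2 (condKernel μ hp Γ x) := hf.sub (memLp_const c)
  have hf0 : ∫ y, (f y - c) ∂condKernel μ hp Γ x = 0 := by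
    rw [integral_sub hfi (integrable_const c)]; simp [hc]
  have key := integral_mul_kernelAverage_le hcond ENNReal.toReal_nonneg hf'
    (h.integral_kernelAverage_erase_sq_le δ hp hΓ (hfm.sub_const c) hf' hf0)
  set A := kernelAverage (fun i => condKernel μ hp (Γ.erase i)) Γ f
  have hA : MemLp A 2 (condKernel μ hp Γ x) := memLp_kernelAverage hcond hf
  have hAi := hA.integrable one_le_two
  have e1 : ∫ y, (f y - c) * kernelAverage (fun i => condKernel μ hp (Γ.erase i)) Γ
      (fun y => f y - c) y ∂condKernel μ hp Γ x =
      ∫ y, f y * A y ∂condKernel μ hp Γ x - c ^ 2 := by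
    have hfA : Integrable (fun y => f y * A y) (condKernel μ hp Γ x) := hf.integrable_mul hA
    have : ∫ y, (f y - c) * kernelAverage (fun i => condKernel μ hp (Γ.erase i)) Γ
        (fun y => f y - c) y ∂condKernel μ hp Γ x =
        ∫ y, (f y * A y - (c * f y + c * (A y - c))) ∂condKernel μ hp Γ x := by
      refine integral_congr_ae ?_
      filter_upwards [ae_kernelAverage_sub_const hcond hΓ hf c] with y hy
      rw [hy]; ring
    have hAc : ∫ y, A y ∂condKernel μ hp Γ x = c := integral_kernelAverage hcond hΓ hf
    have i1 : Integrable (fun y => c * f y) (condKernel μ hp Γ x) := hfi.const_mul c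
    have i2 : Integrable (fun y => c * (A y - c)) (condKernel μ hp Γ x) :=
      (hAi.sub (integrable_const c)).const_mul c
    have i3 : Integrable (fun y => c * f y + c * (A y - c)) (condKernel μ hp Γ x) := i1.add i2
    rw [this, integral_sub hfA i3, integral_add i1 i2, integral_const_mul, integral_const_mul,
      integral_sub hAi (integrable_const c), hAc, ← hc]
    simp
    ring
  have e2 : ∫ y, (f y - c) ^ 2 ∂condKernel μ hp Γ x =
      ∫ y, f y ^ 2 ∂condKernel μ hp Γ x - c ^ 2 := by
    have h1 := variance_eq_sub hf
    have h2 := variance_eq_integral hf.1.aemeasurable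
    simp only [Pi.pow_apply, ← hc] at h1 h2
    rw [← h2, h1]
  rw [e1, e2] at key
  linarith

/-- The Poincaré inequality for the Gibbs sampler of block size `l`. -/
theorem Admissible.poincare (hp : Measurable p) {S : ℕ → ℝ} (hS : ∀ m, S m ≤ 1)
    (hSΓ : ∀ (Γ : Finset ι) (x : ∀ i, X i), Admissible μ p Γ x →
      (sumCorr (condLaw μ p δ Γ x)).toReal ≤ S Γ.card)
    {l m : ℕ} (hlm : l ≤ m) :
    ∀ (Γ : Finset ι) (_ : Γ.card = m) (x : ∀ i, X i) (_ : Admissible μ p Γ x)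
      (f : (∀ i, X i) → ℝ) (_ : Measurable f) (_ : MemLp f 2 (condKernel μ hp Γ x)),
    (∏ j ∈ Finset.Icc (l + 1) m, (1 - S j)) *
        (∫ y, f y ^ 2 ∂condKernel μ hp Γ x - (∫ y, f y ∂condKernel μ hp Γ x) ^ 2) ≤
      ∫ y, f y ^ 2 ∂condKernel μ hp Γ x -
        ∫ y, f y * kernelAverage (condKernel μ hp) (Γ.powersetCard l) f y
          ∂condKernel μ hp Γ x := by
  induction m, hlm using Nat.le_induction with
  | base =>
    intro Γ hΓ x h f hfm hf
    -- With `l = #Γ` one step is an independent draw, so the form is the squared mean; the product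
    -- is empty.
    have e1 : Γ.powersetCard l = {Γ} := by rw [← hΓ, Finset.powersetCard_self]
    have e2 : ∫ y, f y * kernelAverage (condKernel μ hp) (Γ.powersetCard l) f y
        ∂condKernel μ hp Γ x = (∫ y, f y ∂condKernel μ hp Γ x) ^ 2 := by
      rw [sq, ← integral_mul_const]
      refine integral_congr_ae ?_
      filter_upwards [(h.isConditioning hp subset_rfl).const x] with y hy
      simp [kernelAverage, e1, hy]
    rw [e2]
    simp
  | succ m hlm ih =>
    intro Γ hΓ x h f hfm hf
    have hΓne : Γ.Nonempty := Finset.card_pos.1 (by omega)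
    have hprob := h.isProbabilityMeasure hp
    set γ := ∏ j ∈ Finset.Icc (l + 1) m, (1 - S j) with hγ
    have hγ0 : 0 ≤ γ := Finset.prod_nonneg fun j _ => sub_nonneg.2 (hS j)
    have hcond : ∀ B ⊆ Γ, IsConditioning (condKernel μ hp B) (condKernel μ hp Γ x) :=
      fun B hB => h.isConditioning hp hB
    have hvar : 0 ≤ ∫ y, f y ^ 2 ∂condKernel μ hp Γ x - (∫ y, f y ∂condKernel μ hp Γ x) ^ 2 := by
      have h1 := variance_eq_sub hf
      have h2 := variance_nonneg f (condKernel μ hp Γ x)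
      simp only [Pi.pow_apply] at h1
      linarith
    have herase := h.poincare_erase δ hp hΓne hfm hf
    rw [integral_mul_kernelAverage (fun i _ => hcond _ (Finset.erase_subset i Γ)) hf hf] at herase
    have hSx := hSΓ Γ x h
    rw [hΓ] at hSx
    let b : Finset ι → ℝ := fun B => ∫ y, (∫ z, f z ∂condKernel μ hp B y) *
      ∫ z, f z ∂condKernel μ hp B y ∂condKernel μ hp Γ x
    -- The induction hypothesis on each fibre where coordinate `i` is also fixed, integrated over
    -- the fibres. Here `b B = ‖P_B f‖²`, so the left bracket is the expected conditional variance.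
    have hstep : ∀ i ∈ Γ, γ * (∫ y, f y ^ 2 ∂condKernel μ hp Γ x - b (Γ.erase i)) ≤
        ∫ y, f y ^ 2 ∂condKernel μ hp Γ x - (((Γ.erase i).powersetCard l).card : ℝ)⁻¹ *
          ∑ B ∈ (Γ.erase i).powersetCard l, b B := by
      intro i hi
      have hc := hcond _ (Finset.erase_subset i Γ)
      have hcB : ∀ B ∈ (Γ.erase i).powersetCard l,
          IsConditioning (condKernel μ hp B) (condKernel μ hp Γ x) := fun B hB =>
        hcond B ((Finset.mem_powersetCard.1 hB).1.trans (Finset.erase_subset i Γ))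
      rw [← integral_mul_kernelAverage hcB hf hf]
      have i1 := hf.integrable_sq
      have i2 : Integrable (fun y => f y * kernelAverage (condKernel μ hp)
          ((Γ.erase i).powersetCard l) f y) (condKernel μ hp Γ x) :=
        hf.integrable_mul (memLp_kernelAverage hcB hf)
      have i3 := (hc.memLp_integral hf).integrable_sq
      simp only [b, ← sq]
      rw [← hc.integral_integral i1, ← hc.integral_integral i2,
        ← integral_sub (hc.integrable_integral i1) i3, ← integral_const_mul,
        ← integral_sub (hc.integrable_integral i1) (hc.integrable_integral i2)]
      refine integral_mono_ae (((hc.integrable_integral i1).sub i3).const_mul γ)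
        ((hc.integrable_integral i1).sub (hc.integrable_integral i2)) ?_
      filter_upwards [h.ae_admissible hp (Finset.erase_subset i Γ), hc.memLp_ae hf] with y hy hfy
      exact ih _ (by rw [Finset.card_erase_of_mem hi, hΓ, Nat.add_sub_cancel]) y hy f hfm hfy
    have hsum := Finset.sum_le_sum hstep
    have hN : (0 : ℝ) < Γ.card := by exact_mod_cast hΓne.card_pos
    have hsum' := mul_le_mul_of_nonneg_left hsum (inv_nonneg.2 hN.le)
    rw [← Finset.mul_sum, Finset.sum_sub_distrib, Finset.sum_sub_distrib, Finset.sum_const,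
      nsmul_eq_mul, mul_left_comm, mul_sub (Γ.card : ℝ)⁻¹, mul_sub (Γ.card : ℝ)⁻¹,
      inv_mul_cancel_left₀ hN.ne',
      inv_card_mul_sum_erase_powersetCard hΓ hlm b] at hsum'
    rw [integral_mul_kernelAverage (fun B hB => hcond B (Finset.mem_powersetCard.1 hB).1) hf hf]
    refine le_trans ?_ hsum'
    rw [Finset.prod_Icc_succ_top (by omega), ← hγ, mul_assoc]
    refine mul_le_mul_of_nonneg_left (le_trans ?_ herase) hγ0
    exact mul_le_mul_of_nonneg_right (by linarith) hvar

end Gibbs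

/-! ### From Poincaré inequalities to spectral gaps. -/

theorem MeasureTheory.MemLp.eLpNorm_two_eq_sqrt {Ω : Type*} [MeasurableSpace Ω] {ω : Measure Ω}
    {f : Ω → ℝ} (hf : MemLp f 2 ω) : eLpNorm f 2 ω = ENNReal.ofReal √(∫ x, f x ^ 2 ∂ω) := by
  rw [hf.eLpNorm_eq_integral_rpow_norm two_ne_zero ENNReal.ofNat_ne_top, Real.sqrt_eq_rpow]
  simp

theorem corrSup_le_one {ι : Type*} [Fintype ι] [DecidableEq ι] {X : ι → Type*}
    [∀ i, MeasurableSpace (X i)] {μ : ∀ i, Measure (X i)} {p : (∀ i, X i) → ℝ≥0∞}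
    (δ : ∀ Γ : Finset ι, (∀ i : ↥(Γᶜ), X i) → (∀ i : ↥Γ, X i) → ℝ≥0∞) (m : ℕ) :
    corrSup μ p δ m ≤ 1 :=
  iSup_le fun _ => iSup_le fun _ => iSup_le fun _ => iSup_le fun _ => sumCorr_le_one

section Gibbs

open ProbabilityTheory

variable {ι : Type*} [Fintype ι] [DecidableEq ι] {X : ι → Type*} [∀ i, MeasurableSpace (X i)]
  {μ : ∀ i, Measure (X i)} [∀ i, SigmaFinite (μ i)] {p : (∀ i, X i) → ℝ≥0∞}
  (δ : ∀ Γ : Finset ι, (∀ i : ↥(Γᶜ), X i) → (∀ i : ↥Γ, X i) → ℝ≥0∞)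

theorem Admissible.map_condLaw_restrict (hp : Measurable p) {B : Finset ι} (Γ : Finset ι)
    {y : ∀ i, X i} (h : Admissible μ p B y) :
    (condLaw μ p δ B y).map (fun w => Finset.restrict Γ (Function.updateFinset y B w)) =
      (condKernel μ hp B y).map (Finset.restrict Γ) := by
  rw [← h.map_condLaw δ hp, Measure.map_map (measurable_restrict_finset Γ) measurable_updateFinset]
  rfl

theorem integral_gibbsKernel (hp : Measurable p) {Γ : Finset ι} {x : ∀ i, X i} {l : ℕ}
    {z : ∀ i : ↥Γ, X i}
    (hz : ∀ B ∈ Γ.powersetCard l, Admissible μ p B (Function.updateFinset x Γ z))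
    {f : (∀ i : ↥Γ, X i) → ℝ} (hfm : StronglyMeasurable f)
    (hf : ∀ B ∈ Γ.powersetCard l, Integrable (fun y => f (Finset.restrict Γ y))
      (condKernel μ hp B (Function.updateFinset x Γ z))) :
    ∫ w, f w ∂gibbsKernel μ p δ Γ x l z =
      kernelAverage (condKernel μ hp) (Γ.powersetCard l) (fun y => f (Finset.restrict Γ y))
        (Function.updateFinset x Γ z) := by
  have hr := measurable_restrict_finset (X := X) Γ
  rw [gibbsKernel, Finset.sum_congr rfl fun B hB => (hz B hB).map_condLaw_restrict δ hp Γ,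
    integral_smul_measure, integral_finsetSum_measure]
  · rw [kernelAverage, Finset.card_powersetCard, ENNReal.toReal_inv, ENNReal.toReal_natCast,
      smul_eq_mul]
    congr 1
    exact Finset.sum_congr rfl fun B _ => integral_map hr.aemeasurable hfm.aestronglyMeasurable
  · intro B hB
    exact (integrable_map_measure hfm.aestronglyMeasurable hr.aemeasurable).2 (hf B hB)

theorem gibbsKernel_ae_le (hp : Measurable p) {Γ : Finset ι} {x : ∀ i, X i} {l : ℕ}
    {z : ∀ i : ↥Γ, X i}
    (hz : ∀ B ∈ Γ.powersetCard l, Admissible μ p B (Function.updateFinset x Γ z))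
    {q : (∀ i : ↥Γ, X i) → Prop}
    (hq : ∀ B ∈ Γ.powersetCard l, ∀ᵐ w ∂(condKernel μ hp B
      (Function.updateFinset x Γ z)).map (Finset.restrict Γ), q w) :
    ∀ᵐ w ∂gibbsKernel μ p δ Γ x l z, q w := by
  rw [gibbsKernel, Finset.sum_congr rfl fun B hB => (hz B hB).map_condLaw_restrict δ hp Γ]
  refine Measure.ae_smul_measure ?_ _
  rw [ae_iff, Measure.finsetSum_apply]
  exact Finset.sum_eq_zero fun B hB => hq B hB

variable [∀ i, MeasurableSingletonClass (X i)]

/-- A Poincaré inequality bounds the norm of the Markov operator of the Gibbs sampler. -/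
theorem Admissible.markovNorm_gibbsKernel_le (hp : Measurable p) {Γ : Finset ι} {x : ∀ i, X i}
    (h : Admissible μ p Γ x) {l : ℕ} (hl : l ≤ Γ.card) {γ : ℝ} (hγ : γ ≤ 1)
    (hpoin : ∀ f : (∀ i, X i) → ℝ, Measurable f → MemLp f 2 (condKernel μ hp Γ x) →
      γ * (∫ y, f y ^ 2 ∂condKernel μ hp Γ x - (∫ y, f y ∂condKernel μ hp Γ x) ^ 2) ≤
        ∫ y, f y ^ 2 ∂condKernel μ hp Γ x -
          ∫ y, f y * kernelAverage (condKernel μ hp) (Γ.powersetCard l) f y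
            ∂condKernel μ hp Γ x) :
    markovNorm (condLaw μ p δ Γ x) (gibbsKernel μ p δ Γ x l) ≤ ENNReal.ofReal (1 - γ) := by
  refine iSup_le fun f => iSup_le fun hf => iSup_le fun hf0 => iSup_le fun _ =>
    ENNReal.div_le_of_le_mul ?_
  have hprob := h.isProbabilityMeasure hp
  have hcond : ∀ B ∈ Γ.powersetCard l, IsConditioning (condKernel μ hp B) (condKernel μ hp Γ x) :=
    fun B hB => h.isConditioning hp (Finset.mem_powersetCard.1 hB).1
  have hne : (Γ.powersetCard l).Nonempty := Finset.powersetCard_nonempty.2 hl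
  have hr := measurable_restrict_finset (X := X) Γ
  have hU : Measurable (Function.updateFinset x Γ) := measurable_updateFinset
  have hmap := h.map_condLaw δ hp
  have hmap' := h.map_condKernel δ hp
  -- The test function is only almost everywhere measurable; invariance ensures that almost every
  -- Gibbs step does not distinguish it from `g`.
  obtain ⟨g, hgm, hfg⟩ := hf.1
  have hg : MemLp g 2 (condLaw μ p δ Γ x) := (memLp_congr_ae hfg).1 hf
  rw [integral_congr_ae hfg] at hf0
  let G : (∀ i, X i) → ℝ := fun y => g (Finset.restrict Γ y)
  have hGm : Measurable G := hgm.measurable.comp hr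
  have hG : MemLp G 2 (condKernel μ hp Γ x) := by
    rw [← hmap', memLp_map_measure_iff hgm.aestronglyMeasurable hr.aemeasurable] at hg
    exact hg
  have hG0 : ∫ y, G y ∂condKernel μ hp Γ x = 0 := by
    rw [← hmap', integral_map hr.aemeasurable hgm.aestronglyMeasurable] at hf0
    exact hf0
  have hfG : ∀ᵐ y ∂condKernel μ hp Γ x, f (Finset.restrict Γ y) = G y := by
    rw [← hmap'] at hfg
    exact ae_of_ae_map hr.aemeasurable hfg
  have hAm : Measurable (kernelAverage (condKernel μ hp) (Γ.powersetCard l) G) :=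
    measurable_kernelAverage hGm
  have hA := memLp_kernelAverage hcond hG
  have hK : (fun z => ∫ w, f w ∂gibbsKernel μ p δ Γ x l z) =ᵐ[condLaw μ p δ Γ x]
      kernelAverage (condKernel μ hp) (Γ.powersetCard l) G ∘ Function.updateFinset x Γ := by
    have h1 : ∀ᵐ y ∂condKernel μ hp Γ x, ∀ B ∈ Γ.powersetCard l, Admissible μ p B y ∧
        Integrable G (condKernel μ hp B y) ∧
        ∀ᵐ w ∂(condKernel μ hp B y).map (Finset.restrict Γ), f w = g w := by
      refine (Filter.eventually_all_finset _).2 fun B hB => ?_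
      have hBΓ := (Finset.mem_powersetCard.1 hB).1
      have h2 : ∀ᵐ y ∂condKernel μ hp Γ x,
          ∀ᵐ w ∂(condKernel μ hp B y).map (Finset.restrict Γ), f w = g w := by
        -- The exceptional set may fail to be measurable, whereas the passage to the image measure
        -- below requires measurability.
        obtain ⟨t, ht, htm, ht0⟩ := exists_measurable_superset_of_null (ae_iff.1 hfg)
        have h3 : ∀ᵐ w ∂condLaw μ p δ Γ x, w ∉ t := measure_eq_zero_iff_ae_notMem.1 ht0
        rw [← hmap'] at h3
        filter_upwards [(hcond B hB).ae_ae (ae_of_ae_map hr.aemeasurable h3)] with y hy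
        have h4 : ∀ᵐ w ∂(condKernel μ hp B y).map (Finset.restrict Γ), w ∉ t :=
          (ae_map_iff hr.aemeasurable htm.compl).2 hy
        filter_upwards [h4] with w hw
        by_contra hne
        exact hw (ht hne)
      filter_upwards [h.ae_admissible hp hBΓ,
        (hcond B hB).integrable_ae (hG.integrable one_le_two), h2] with y a b c
      exact ⟨a, b, c⟩
    rw [← hmap] at h1
    filter_upwards [ae_of_ae_map hU.aemeasurable h1] with z hz
    rw [integral_congr_ae (gibbsKernel_ae_le δ hp (fun B hB => (hz B hB).1)
      (q := fun w => f w = g w) fun B hB => (hz B hB).2.2)]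
    exact integral_gibbsKernel δ hp (fun B hB => (hz B hB).1) hgm fun B hB => (hz B hB).2.1
  have e1 : eLpNorm (fun z => ∫ w, f w ∂gibbsKernel μ p δ Γ x l z) 2 (condLaw μ p δ Γ x) =
      eLpNorm (kernelAverage (condKernel μ hp) (Γ.powersetCard l) G) 2 (condKernel μ hp Γ x) := by
    rw [eLpNorm_congr_ae hK, ← hmap, eLpNorm_map_measure hAm.aestronglyMeasurable hU.aemeasurable]
  have e2 : eLpNorm f 2 (condLaw μ p δ Γ x) = eLpNorm G 2 (condKernel μ hp Γ x) := by
    rw [eLpNorm_congr_ae hfg, ← hmap',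
      eLpNorm_map_measure hgm.aestronglyMeasurable hr.aemeasurable]
    rfl
  have key := integral_kernelAverage_sq_le hcond hne (sub_nonneg.2 hγ)
    (fun u hum hu hu0 => by
      have := hpoin u hum hu
      rw [hu0] at this
      linarith) hGm hG hG0
  rw [e1, e2, hA.eLpNorm_two_eq_sqrt, hG.eLpNorm_two_eq_sqrt,
    ← ENNReal.ofReal_mul (sub_nonneg.2 hγ)]
  refine ENNReal.ofReal_le_ofReal ((Real.sqrt_le_sqrt key).trans_eq ?_)
  rw [Real.sqrt_mul (sq_nonneg _), Real.sqrt_sq (sub_nonneg.2 hγ)]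

theorem prod_one_sub_corrSup_le_Gap (hp : Measurable p) {l m : ℕ} (hlm : l ≤ m) :
    ∏ j ∈ Finset.Icc (l + 1) m, (1 - (corrSup μ p δ j : EReal)) ≤ Gap μ p δ m l := by
  have hS : ∀ j, (corrSup μ p δ j).toReal ≤ 1 := fun j =>
    ENNReal.toReal_le_of_le_ofReal zero_le_one (by simpa using corrSup_le_one δ j)
  have hne : ∀ j, corrSup μ p δ j ≠ ∞ := fun j =>
    ne_top_of_le_ne_top ENNReal.one_ne_top (corrSup_le_one δ j)
  have hcoe : ∏ j ∈ Finset.Icc (l + 1) m, (1 - (corrSup μ p δ j : EReal)) =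
      ((∏ j ∈ Finset.Icc (l + 1) m, (1 - (corrSup μ p δ j).toReal) : ℝ) : EReal) := by
    induction Finset.Icc (l + 1) m using Finset.induction_on with
    | empty => simp
    | insert a s ha ih =>
      rw [Finset.prod_insert ha, Finset.prod_insert ha, ih, EReal.coe_mul, EReal.coe_sub,
        EReal.coe_one, EReal.coe_ennreal_toReal (hne a)]
  rw [hcoe]
  refine le_iInf fun Γ => le_iInf fun hΓ => le_iInf fun x => le_iInf fun h => ?_
  set γ := ∏ j ∈ Finset.Icc (l + 1) m, (1 - (corrSup μ p δ j).toReal)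
  have hγ : γ ≤ 1 := Finset.prod_le_one (fun j _ => sub_nonneg.2 (hS j))
    fun j _ => sub_le_self _ ENNReal.toReal_nonneg
  have hN := h.markovNorm_gibbsKernel_le δ hp (hlm.trans_eq hΓ.symm) hγ
    (h.poincare δ hp hS (fun Γ x h => ENNReal.toReal_mono (hne _)
      (le_iSup_of_le Γ (le_iSup_of_le rfl (le_iSup_of_le x (le_iSup_of_le h le_rfl)))))
      hlm Γ hΓ x · · ·)
  have e : (γ : EReal) = 1 - ((ENNReal.ofReal (1 - γ) : ℝ≥0∞) : EReal) := by
    rw [EReal.coe_ennreal_ofReal, max_eq_left (sub_nonneg.2 hγ), ← EReal.coe_one, ← EReal.coe_sub,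
      sub_sub_cancel]
  rw [e, spectralGap]
  exact EReal.sub_le_sub le_rfl (EReal.coe_ennreal_le_coe_ennreal_iff.2 hN)

end Gibbs

theorem corollary1 {n : ℕ} (hn : 2 ≤ n) {X : Fin n → Type*}
    [∀ i, MeasurableSpace (X i)] [∀ i, MeasurableSingletonClass (X i)]
    (μ : ∀ i, Measure (X i)) [∀ i, SigmaFinite (μ i)]
    (P : Measure (∀ i, X i)) [IsProbabilityMeasure P]
    (p : (∀ i, X i) → ℝ≥0∞) (hp : Measurable p) (hP : P = (Measure.pi μ).withDensity p)
    (δ : ∀ Γ : Finset (Fin n), (∀ i : ↥(Γᶜ), X i) → (∀ i : ↥Γ, X i) → ℝ≥0∞)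
    (hδ : ∀ (Γ : Finset (Fin n)) (y : ∀ i : ↥(Γᶜ), X i), Measurable (δ Γ y))
    (hδ1 : ∀ (Γ : Finset (Fin n)) (y : ∀ i : ↥(Γᶜ), X i), ∫⁻ w, δ Γ y w ∂(Measure.pi fun i : ↥Γ => μ i) = 1) :
    (∀ m : ℕ, 2 ≤ m → m ≤ n →
      1 - (corrSup μ p δ m : EReal) ≤ Gap μ p δ m (m - 1)) ∧
    (∀ l : ℕ, 1 ≤ l → l < n →
      ∏ m ∈ Finset.Icc (l + 1) n, (1 - (corrSup μ p δ m : EReal)) ≤ Gap μ p δ n l) := by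
  refine ⟨fun m hm _ => ?_, fun l _ hl => prod_one_sub_corrSup_le_Gap δ hp hl.le⟩
  -- The one-step bound is the case `l = m - 1`, where the product has the single factor `j = m`.
  have := prod_one_sub_corrSup_le_Gap δ hp (μ := μ) (Nat.sub_le m 1)
  rwa [Nat.sub_add_cancel (by omega), Finset.Icc_self, Finset.prod_singleton] at this
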